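/- Let $K$ be a global function field with constant field $\mathbb{F}_q$ (so $K$ is a finite extension of a rational function field $\mathbb{F}_q(t)$), let $S$ be a finite set of places of $K$, and let $D=\mathcal{O}_S$ be the ring of all elements of $K$ that are integral at every place outside $S$. For an ideal $\mathfrak{q}$ of $D$ put $SL_2(D,\mathfrak{q})=\{X\in SL_2(D): X\equiv I_2 \pmod{\mathfrak{q}}\}$. Let $N$ be a normal congruence subgroup of $SL_2(D)$, that is, a normal subgroup containing $SL_2(D,\mathfrak{q}')$ for some nonzero ideal $\mathfrak{q}'$ of $D$. Let $l(N)$ be the level of $N$, that is, the largest ideal $\mathfrak{q}$ of $D$ such that $N$ contains the normal subgroup of $SL_2(D)$ generated by all matrices $\begin{pmatrix}1&a\\0&1\end{pmatrix}$ with $a\in\mathfrak{q}$. Then $N$ has finite index in $SL_2(D)$, and: (a) If $\mathrm{char}(\mathbb{F}_q)=3$, then $|D/l(N)|$ divides $3^r\,|SL_2(D):N|$, where $r$ is the (finite) number of prime ideals $\mathfrak{p}$ of $D$ with $|D/\mathfrak{p}|=3$. (b) If $\mathrm{char}(\mathbb{F}_q)=2$, then $|D/l(N)|$ divides $4^s\,|SL_2(D):N|^2$,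 where $s$ is the (finite) number of prime ideals $\mathfrak{p}$ of $D$ with $|D/\mathfrak{p}|=2$. -/

import Mathlib

/-- A place of a field `K`, given by its valuation ring: a valuation ring of `K` other than `K`.
For a finite extension `K` of `𝔽_q(t)` every such ring contains the field of constants and is a
discrete valuation ring, so these are the usual places of the function field `K`. -/
abbrev Place (K : Type*) [Field K] : Type _ := {v : ValuationSubring K // v ≠ ⊤}

/-- The ring `𝒪_S` of all elements of `K` that are integral at every place outside `S`. -/
def SIntegers {K : Type*} [Field K] (S : Set (Place K)) : Subring K :=
  ⨅ (v : Place K) (_ : v ∉ S), v.1.toSubring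

theorem mem_SIntegers {K : Type*} [Field K] {S : Set (Place K)} {x : K} :
    x ∈ SIntegers S ↔ ∀ v : Place K, v ∉ S → x ∈ v.1 := by
  simp [SIntegers, Subring.mem_iInf]

section SL2

variable {R : Type*} [CommRing R]

/-- The translation matrix `T(r) = (1 r; 0 1)`. -/
def translation (r : R) : Matrix.SpecialLinearGroup (Fin 2) R :=
  ⟨!![1, r; 0, 1], by simp⟩

/-- The principal congruence subgroup `SL₂(R, 𝔮)`: all `X ∈ SL₂(R)` with `X ≡ I₂ mod 𝔮`. -/
def principalCongruenceSubgroup (q : Ideal R) : Subgroup (Matrix.SpecialLinearGroup (Fin 2) R) :=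
  (Matrix.SpecialLinearGroup.map (n := Fin 2) (Ideal.Quotient.mk q)).ker

/-- `H` is a congruence subgroup if it contains `SL₂(R, 𝔮)` for some nonzero ideal `𝔮`. -/
def IsCongruenceSubgroup (H : Subgroup (Matrix.SpecialLinearGroup (Fin 2) R)) : Prop :=
  ∃ q : Ideal R, q ≠ ⊥ ∧ principalCongruenceSubgroup q ≤ H

/-- `NE₂(R, 𝔮)`: the normal subgroup of `SL₂(R)` generated by all `T(r)` with `r ∈ 𝔮`. -/
def NE2 (q : Ideal R) : Subgroup (Matrix.SpecialLinearGroup (Fin 2) R) :=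
  Subgroup.normalClosure (translation '' (q : Set R))

/-- The level of `H`: the largest ideal `𝔮` with `NE₂(R, 𝔮) ≤ H` (see `isGreatest_level`). -/
def level (H : Subgroup (Matrix.SpecialLinearGroup (Fin 2) R)) : Ideal R :=
  sSup {q : Ideal R | NE2 q ≤ H}

theorem NE2_le_iff (q : Ideal R) (H : Subgroup (Matrix.SpecialLinearGroup (Fin 2) R)) :
    NE2 q ≤ H ↔ ∀ r ∈ q, translation r ∈ H.normalCore := by
  have h1 : NE2 q ≤ H ↔ NE2 q ≤ H.normalCore :=
    haveI : (NE2 q).Normal := Subgroup.normalClosure_normal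
    Subgroup.normal_le_normalCore.symm
  rw [h1]
  constructor
  · exact fun h r hr => h (Subgroup.subset_normalClosure ⟨r, hr, rfl⟩)
  · rintro h
    refine Subgroup.normalClosure_le_normal ?_
    rintro _ ⟨r, hr, rfl⟩
    exact h r hr

theorem translation_add (a b : R) : translation (a + b) = translation a * translation b := by
  apply Subtype.ext
  rw [Matrix.SpecialLinearGroup.coe_mul]
  simp [translation, add_comm]

theorem translation_zero : translation (0 : R) = 1 := by
  apply Subtype.ext
  rw [Matrix.SpecialLinearGroup.coe_one]
  simp [translation, Matrix.one_fin_two]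

theorem isGreatest_level (H : Subgroup (Matrix.SpecialLinearGroup (Fin 2) R)) :
    IsGreatest {q : Ideal R | NE2 q ≤ H} (level H) := by
  refine ⟨(NE2_le_iff _ _).2 fun r hr => ?_, fun q hq => le_sSup hq⟩
  rw [level, sSup_eq_iSup'] at hr
  refine Submodule.iSup_induction _ (motive := fun r => translation r ∈ H.normalCore) hr
    (fun q x hx => (NE2_le_iff _ _).1 q.2 x hx) ?_ fun x y hx hy => ?_
  · rw [translation_zero]; exact one_mem _
  · rw [translation_add]; exact mul_mem hx hy

end SL2

/-- The prime ideals `𝔭` of `R` with `|R/𝔭| = n`. -/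
def primesOfResidueCard (R : Type*) [CommRing R] (n : ℕ) : Set (Ideal R) :=
  {p | p.IsPrime ∧ Nat.card (R ⧸ p) = n}

/-! The additive group `translationKernel N` of all `a` with `translation a ∈ N` has index dividing
`N.index`, so the point is to find a large ideal inside it. Modulo a nonzero ideal `q` with
`principalCongruenceSubgroup q ≤ N`, the ring becomes a finite product of local rings, the quotients
of D by prime powers. At each factor let P be the projection and Q the section of the resulting
additive group. The product of the indices of the P's divides `N.index`, and the sum of the Q's lies
in the group. So it suffices to find, at each factor, an ideal inside Q whose index is controlled by
that of P.

Conjugation by diag(u, u⁻¹) gives (u² - 1)P ⊆ Q. In characteristic 3, differences of squares of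
units recover linear multiples, so P is an ideal contained in Q, or, when the residue field has 3
elements, at least mP ⊆ Q for the maximal ideal m (`exists_ideal_char_three`).

In characteristic 2 squares are additive and this fails. Conjugating by lower triangular matrices as
well produces terms quadratic in x ∈ P (`lower_mul_upper_mem`, `central`); these give ideals built
from x², which is why the index appears squared (`exists_ideal_char_two`).

`natCard_quotient_level_dvd` multiplies the local bounds; only primes with residue field of 3 (resp.
2) elements contribute an extra factor. -/

/-! ### Elementary matrices and groups normalized by them -/

section ElementaryMatrices


variable {R : Type*} [CommRing R]

/-- The lower triangular elementary matrix `(1 0; r 1)`. -/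
def lowerTranslation (r : R) : Matrix.SpecialLinearGroup (Fin 2) R :=
  ⟨!![1, 0; r, 1], by simp⟩

/-- The diagonal matrix `diag(u, v)` for `u v = 1`. -/
def diagonalUnit (u v : R) (h : u * v = 1) : Matrix.SpecialLinearGroup (Fin 2) R :=
  ⟨!![u, 0; 0, v], by simp [h]⟩

theorem coe_translation (r : R) :
    (translation r : Matrix (Fin 2) (Fin 2) R) = !![1, r; 0, 1] := rfl

theorem coe_lowerTranslation (r : R) :
    (lowerTranslation r : Matrix (Fin 2) (Fin 2) R) = !![1, 0; r, 1] := rfl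

theorem coe_diagonalUnit {u v : R} (h : u * v = 1) :
    (diagonalUnit u v h : Matrix (Fin 2) (Fin 2) R) = !![u, 0; 0, v] := rfl

theorem lowerTranslation_add (a b : R) :
    lowerTranslation (a + b) = lowerTranslation a * lowerTranslation b := by
  ext i j
  rw [Matrix.SpecialLinearGroup.coe_mul, coe_lowerTranslation, coe_lowerTranslation, coe_lowerTranslation]
  fin_cases i <;> fin_cases j <;> simp

theorem lowerTranslation_zero : lowerTranslation (0 : R) = 1 := by
  ext i j
  rw [Matrix.SpecialLinearGroup.coe_one, coe_lowerTranslation, Matrix.one_fin_two]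

theorem translation_neg (a : R) : translation (-a) = (translation a)⁻¹ := by
  rw [eq_inv_iff_mul_eq_one, ← translation_add, neg_add_cancel, translation_zero]

theorem lowerTranslation_neg (a : R) : lowerTranslation (-a) = (lowerTranslation a)⁻¹ := by
  rw [eq_inv_iff_mul_eq_one, ← lowerTranslation_add, neg_add_cancel, lowerTranslation_zero]

theorem diagonalUnit_mul_translation {u v : R} (h : u * v = 1) (a : R) :
    diagonalUnit u v h * translation a = translation (u ^ 2 * a) * diagonalUnit u v h := by
  ext i j
  simp only [Matrix.SpecialLinearGroup.coe_mul, coe_diagonalUnit, coe_translation]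
  fin_cases i <;> fin_cases j <;> simp
  linear_combination (- u * a) * h

theorem diagonalUnit_mul_lowerTranslation {u v : R} (h : u * v = 1) (a : R) :
    diagonalUnit u v h * lowerTranslation a = lowerTranslation (v ^ 2 * a) * diagonalUnit u v h := by
  ext i j
  simp only [Matrix.SpecialLinearGroup.coe_mul, coe_diagonalUnit, coe_lowerTranslation]
  fin_cases i <;> fin_cases j <;> simp
  linear_combination (- v * a) * h

theorem diagonalUnit_eq {u v : R} (h : u * v = 1) :
    diagonalUnit u v h = translation u * lowerTranslation (-v) * translation u *
      (translation 1 * lowerTranslation (-1) * translation 1)⁻¹ := by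
  rw [eq_mul_inv_iff_mul_eq]
  ext i j
  simp only [Matrix.SpecialLinearGroup.coe_mul, coe_diagonalUnit, coe_translation, coe_lowerTranslation]
  fin_cases i <;> fin_cases j <;> simp [h, mul_comm v u]

theorem weyl_mul_translation (a : R) :
    (translation 1 * lowerTranslation (-1) * translation 1) * translation a =
      lowerTranslation (-a) * (translation 1 * lowerTranslation (-1) * translation 1) := by
  ext i j
  simp only [Matrix.SpecialLinearGroup.coe_mul, coe_translation, coe_lowerTranslation]
  fin_cases i <;> fin_cases j <;> simp

/-- The lower-diagonal-upper factorization of a conjugated translation; it exists because the upper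
left entry `1 + x * y` is a unit. -/
theorem lower_conj_translation_eq {x y a c : R} (ha : a = 1 + x * y) (h : a * c = 1) :
    lowerTranslation (-y) * translation x * lowerTranslation y =
      lowerTranslation (-(x * y ^ 2 * c)) * diagonalUnit a c h * translation (x * c) := by
  subst ha
  ext i j
  simp only [Matrix.SpecialLinearGroup.coe_mul, coe_translation, coe_lowerTranslation, coe_diagonalUnit]
  fin_cases i <;> fin_cases j <;> simp
  · linear_combination (-x) * h
  · linear_combination (x * y ^ 2) * h
  · linear_combination (-1 + x * y + x ^ 2 * y ^ 2 * c) * h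

variable {N : Subgroup (Matrix.SpecialLinearGroup (Fin 2) R)}

/-- The group `N` is normalized by all elementary matrices. -/
structure ElementaryNormalized (N : Subgroup (Matrix.SpecialLinearGroup (Fin 2) R)) : Prop where
  upper (x : R) : translation x ∈ Subgroup.normalizer (N : Set (Matrix.SpecialLinearGroup (Fin 2) R))
  lower (x : R) : lowerTranslation x ∈ Subgroup.normalizer (N : Set (Matrix.SpecialLinearGroup (Fin 2) R))

namespace ElementaryNormalized

theorem diagonalUnit_mem (hN : ElementaryNormalized N) {u v : R} (h : u * v = 1) :
    diagonalUnit u v h ∈ Subgroup.normalizer (N : Set (Matrix.SpecialLinearGroup (Fin 2) R)) := by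
  rw [diagonalUnit_eq]
  exact mul_mem (mul_mem (mul_mem (hN.upper _) (hN.lower _)) (hN.upper _))
    (inv_mem (mul_mem (mul_mem (hN.upper _) (hN.lower _)) (hN.upper _)))

theorem conj_mem {g n : Matrix.SpecialLinearGroup (Fin 2) R}
    (hg : g ∈ Subgroup.normalizer (N : Set (Matrix.SpecialLinearGroup (Fin 2) R))) (hn : n ∈ N) :
    g * n * g⁻¹ ∈ N :=
  (Subgroup.mem_normalizer_iff.1 hg n).1 hn

theorem translation_sq_mul_mem (hN : ElementaryNormalized N) {u v a : R} (h : u * v = 1)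
    (ha : translation a ∈ N) : translation (u ^ 2 * a) ∈ N := by
  have := conj_mem (hN.diagonalUnit_mem h) ha
  rwa [diagonalUnit_mul_translation, mul_inv_cancel_right] at this

theorem lowerTranslation_mem (hN : ElementaryNormalized N) {a : R}
    (ha : translation a ∈ N) : lowerTranslation a ∈ N := by
  have := conj_mem (mul_mem (mul_mem (hN.upper 1) (hN.lower (-1))) (hN.upper 1)) (inv_mem ha)
  rwa [← translation_neg, weyl_mul_translation, mul_inv_cancel_right, neg_neg] at this

/-- Compare the factorization in `lower_conj_translation_eq` with its conjugate by diag(u, v): the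
diagonal parts agree and cancel in the quotient. Multiplying by a translation in N then leaves c - 1
= -xyc in the upper entry, which makes it quadratic in x. -/
theorem lower_mul_upper_mem (hN : ElementaryNormalized N) {x y a c u v : R}
    (hx : translation x ∈ N) (ha : a = 1 + x * y) (hc : a * c = 1) (huv : u * v = 1) :
    lowerTranslation (a * x * y ^ 2 * (1 - v ^ 2)) *
      translation (-((u ^ 2 - 1) * x ^ 2 * y * c)) ∈ N := by
  have hg : lowerTranslation (-(x * y ^ 2 * c)) * diagonalUnit a c hc * translation (x * c) ∈ N := by
    rw [← lower_conj_translation_eq ha]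
    have := conj_mem (hN.lower (-y)) hx
    rwa [← lowerTranslation_neg, neg_neg] at this
  have hg' : lowerTranslation (v ^ 2 * -(x * y ^ 2 * c)) * diagonalUnit a c hc *
      translation (u ^ 2 * (x * c)) ∈ N := by
    have := conj_mem (hN.diagonalUnit_mem huv) hg
    convert this using 1
    rw [eq_mul_inv_iff_mul_eq]
    simp only [mul_assoc]
    rw [← diagonalUnit_mul_translation huv]
    simp only [← mul_assoc]
    rw [diagonalUnit_mul_lowerTranslation huv]
    congr 1
    simp only [mul_assoc]
    congr 1
    ext i j
    simp only [Matrix.SpecialLinearGroup.coe_mul, coe_diagonalUnit]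
    fin_cases i <;> fin_cases j <;> simp [mul_comm]
  have h1 := conj_mem (hN.upper (x * c)) (mul_mem (inv_mem hg) hg')
  have h2 : translation (-((u ^ 2 - 1) * x)) ∈ N := by
    have := mul_mem (inv_mem (hN.translation_sq_mul_mem huv hx)) hx
    rw [← translation_neg, ← translation_add] at this
    convert this using 2
    ring
  have h3 := mul_mem h1 h2
  convert h3 using 1
  simp only [mul_inv_rev, mul_assoc, mul_inv_cancel_left]
  rw [← translation_neg, ← translation_add, ← translation_add, ← lowerTranslation_neg,
    ← mul_assoc (lowerTranslation _) (lowerTranslation _), ← lowerTranslation_add,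
    eq_inv_mul_iff_mul_eq, ← mul_assoc, diagonalUnit_mul_lowerTranslation, mul_assoc]
  congr 1
  · congr 1
    linear_combination (x * y ^ 2 * (1 - v ^ 2) * c) * hc
  · congr 2
    subst ha
    linear_combination (-(u ^ 2 - 1) * x) * hc

/-- Modulo N, `translation B` equals the inverse of `lowerTranslation A`, so it commutes with upper
and lower elementary matrices alike, hence with diag(u, v), which is a product of them. -/
theorem central (hN : ElementaryNormalized N) {A B u v : R}
    (h : lowerTranslation A * translation B ∈ N) (huv : u * v = 1) :
    translation ((u ^ 2 - 1) * B) ∈ N := by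
  -- C consists of the normalizing elements that commute with `translation B` modulo N.
  let C : Subgroup (Matrix.SpecialLinearGroup (Fin 2) R) :=
    { carrier := {g | g ∈ Subgroup.normalizer (N : Set (Matrix.SpecialLinearGroup (Fin 2) R)) ∧
        g * translation B * g⁻¹ * (translation B)⁻¹ ∈ N}
      one_mem' := ⟨one_mem _, by simp⟩
      mul_mem' := by
        rintro g k ⟨hg, hg'⟩ ⟨hk, hk'⟩
        refine ⟨mul_mem hg hk, ?_⟩
        convert mul_mem (conj_mem hg hk') hg' using 1
        group
      inv_mem' := by
        rintro g ⟨hg, hg'⟩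
        refine ⟨inv_mem hg, ?_⟩
        convert inv_mem (conj_mem (inv_mem hg) hg') using 1
        group }
  have hE : ∀ x, translation x ∈ C := fun x => ⟨hN.upper x, by
    rw [← translation_add, add_comm, translation_add]; simp⟩
  have hF : ∀ x, lowerTranslation x ∈ C := fun x => ⟨hN.lower x, by
    have e : lowerTranslation x * translation B * (lowerTranslation x)⁻¹ * (translation B)⁻¹ =
      (lowerTranslation A)⁻¹ * (lowerTranslation x * (lowerTranslation A * translation B) *
        (lowerTranslation x)⁻¹ * (lowerTranslation A * translation B)⁻¹) *
          (lowerTranslation A)⁻¹⁻¹ := by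
      have : lowerTranslation x * lowerTranslation A = lowerTranslation A * lowerTranslation x := by
        rw [← lowerTranslation_add, add_comm, lowerTranslation_add]
      rw [← mul_assoc (lowerTranslation x), this]
      group
    rw [e]
    exact conj_mem (inv_mem (hN.lower A)) (mul_mem (conj_mem (hN.lower x) h) (inv_mem h))⟩
  have hd : diagonalUnit u v huv ∈ C := by
    rw [diagonalUnit_eq]
    exact mul_mem (mul_mem (mul_mem (hE _) (hF _)) (hE _))
      (inv_mem (mul_mem (mul_mem (hE _) (hF _)) (hE _)))
  have := hd.2
  rw [diagonalUnit_mul_translation, mul_inv_cancel_right, ← translation_neg,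
    ← translation_add] at this
  convert this using 2
  ring

end ElementaryNormalized

/-- The additive group of all `a` whose translation lies in `N`. -/
def translationKernel (N : Subgroup (Matrix.SpecialLinearGroup (Fin 2) R)) : AddSubgroup R where
  carrier := {a | translation a ∈ N}
  zero_mem' := by
    rw [Set.mem_ofPred_eq, translation_zero]
    exact one_mem _
  add_mem' := fun {a b} ha hb => by
    rw [Set.mem_ofPred_eq, translation_add]
    exact mul_mem ha hb
  neg_mem' := fun {a} ha => by
    rw [Set.mem_ofPred_eq, translation_neg]
    exact inv_mem ha

theorem mem_translationKernel {a : R} : a ∈ translationKernel N ↔ translation a ∈ N := Iff.rfl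

/-- The index is the order of the image of the translations in the quotient group by N, so Lagrange
applies. -/
theorem index_translationKernel_dvd [N.Normal] : (translationKernel N).index ∣ N.index := by
  let T : Multiplicative R →* Matrix.SpecialLinearGroup (Fin 2) R :=
    { toFun := fun a => translation a.toAdd
      map_one' := translation_zero
      map_mul' := fun a b => translation_add _ _ }
  have h : (translationKernel N).index = (N.comap T).index := rfl
  rw [h, Subgroup.index_comap]
  exact Subgroup.relIndex_dvd_index_of_normal _ _

end ElementaryMatrices

/-! ### Finite local rings and their additive subgroups -/

section LocalRing

variable {S : Type*} [CommRing S]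

theorem Ideal.natCard_quotient_eq_index (I : Ideal S) :
    Nat.card (S ⧸ I) = I.toAddSubgroup.index := rfl

theorem Ideal.natCard_quotient_span_mul_dvd (a b : S) :
    Nat.card (S ⧸ Ideal.span {a * b}) ∣
      Nat.card (S ⧸ Ideal.span {a}) * Nat.card (S ⧸ Ideal.span {b}) := by
  have hle : (Ideal.span {a * b}).toAddSubgroup ≤ (Ideal.span {a}).toAddSubgroup := by
    intro x hx
    rw [Submodule.mem_toAddSubgroup, Ideal.mem_span_singleton] at *
    exact (dvd_mul_right a b).trans hx
  have hrange : (Ideal.span {a}).toAddSubgroup = (AddMonoidHom.mulLeft a).range := by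
    ext x
    rw [Submodule.mem_toAddSubgroup, Ideal.mem_span_singleton]
    exact ⟨fun ⟨c, hc⟩ => ⟨c, hc.symm⟩, fun ⟨c, hc⟩ => ⟨c, hc.symm⟩⟩
  simp only [Ideal.natCard_quotient_eq_index]
  rw [← AddSubgroup.relIndex_mul_index hle, mul_comm]
  refine mul_dvd_mul_left _ ?_
  conv_lhs => rw [hrange, ← AddSubgroup.index_comap]
  refine AddSubgroup.index_dvd_of_le fun x hx => ?_
  rw [Submodule.mem_toAddSubgroup, Ideal.mem_span_singleton] at hx
  rw [AddSubgroup.mem_comap, Submodule.mem_toAddSubgroup, Ideal.mem_span_singleton]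
  exact mul_dvd_mul_left a hx

section Local

variable [IsLocalRing S]

theorem IsLocalRing.exists_isUnit_sub (F : Finset S)
    (hF : F.card < Nat.card (S ⧸ IsLocalRing.maximalIdeal S)) :
    ∃ u : S, ∀ f ∈ F, IsUnit (u - f) := by
  classical
  have : ∃ r : S ⧸ IsLocalRing.maximalIdeal S, r ∉ F.image (Ideal.Quotient.mk _) := by
    by_contra! hall
    have h1 : (Set.univ : Set (S ⧸ IsLocalRing.maximalIdeal S)).ncard ≤
        (F.image (Ideal.Quotient.mk (IsLocalRing.maximalIdeal S)) : Set _).ncard :=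
      Set.ncard_le_ncard (fun r _ => hall r) (Finset.finite_toSet _)
    rw [Set.ncard_univ, Set.ncard_coe_finset] at h1
    exact absurd (h1.trans Finset.card_image_le) (not_le.2 hF)
  obtain ⟨r, hr⟩ := this
  obtain ⟨u, rfl⟩ := Ideal.Quotient.mk_surjective r
  refine ⟨u, fun f hf => ?_⟩
  by_contra hu
  have : u - f ∈ IsLocalRing.maximalIdeal S := hu
  exact hr (Finset.mem_image.2 ⟨f, hf, ((Ideal.Quotient.mk_eq_mk_iff_sub_mem _ _).2 this).symm⟩)

theorem IsLocalRing.isUnit_add_of_mem {u r : S} (hu : IsUnit u)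
    (hr : r ∈ IsLocalRing.maximalIdeal S) : IsUnit (u + r) := by
  by_contra h
  have h' : u + r ∈ IsLocalRing.maximalIdeal S := h
  have := sub_mem h' hr
  rw [add_sub_cancel_right] at this
  exact this hu

/-- A Nakayama argument: if no element of P were a unit multiple of the generator g of the ideal
spanned by P, then g would lie in g·m, forcing g = 0. -/
theorem AddSubgroup.exists_mem_forall_dvd [IsPrincipalIdealRing S] (P : AddSubgroup S) :
    ∃ x₀ ∈ P, ∀ x ∈ P, x₀ ∣ x := by
  obtain ⟨g, hg⟩ := IsPrincipalIdealRing.principal (Ideal.span (P : Set S))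
  have hg' : Ideal.span (P : Set S) = Ideal.span {g} := hg
  have hdvd : ∀ x ∈ P, g ∣ x := fun x hx => by
    rw [← Ideal.mem_span_singleton, ← hg']
    exact Ideal.subset_span hx
  by_cases h : ∃ x ∈ P, ∃ u, IsUnit u ∧ x = g * u
  · obtain ⟨x, hx, u, hu, rfl⟩ := h
    exact ⟨_, hx, fun y hy => (hu.mul_right_dvd).2 (hdvd y hy)⟩
  · push Not at h
    have hle : Ideal.span (P : Set S) ≤ Ideal.span {g} * IsLocalRing.maximalIdeal S := by
      rw [Ideal.span_le]
      intro x hx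
      obtain ⟨s, rfl⟩ := hdvd x hx
      exact Ideal.mem_span_singleton_mul.2 ⟨s, fun hs => h _ hx s hs rfl, rfl⟩
    have hgm : g ∈ Ideal.span {g} * IsLocalRing.maximalIdeal S :=
      hle (hg' ▸ Ideal.mem_span_singleton_self g)
    obtain ⟨s, hs, hgs⟩ := Ideal.mem_span_singleton_mul.1 hgm
    have hunit : IsUnit (1 + -s) := IsLocalRing.isUnit_add_of_mem isUnit_one (neg_mem hs)
    have hg0 : g = 0 := by
      rw [← hunit.mul_left_eq_zero]
      linear_combination -hgs
    exact ⟨0, zero_mem _, fun x hx => hg0 ▸ hdvd x hx⟩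

end Local

variable [Finite S]

theorem exists_natCard_eq_prime_pow (p : ℕ) [Fact p.Prime] [CharP S p] :
    ∃ n, Nat.card S = p ^ n := by
  let := ZMod.algebra S p
  have : Module.Finite (ZMod p) S := Module.Finite.of_finite
  exact ⟨_, by rw [Module.natCard_eq_pow_finrank (K := ZMod p) (V := S), Nat.card_zmod]⟩

theorem exists_pow_mul_eq_self_of_isUnit {w : S} (hw : IsUnit w) : ∃ k, w ^ k * w = 1 := by
  obtain ⟨w, rfl⟩ := hw
  refine ⟨orderOf w - 1, ?_⟩
  have := orderOf_pos w
  rw [← pow_succ, Nat.sub_add_cancel this, ← Units.val_pow_eq_pow_val, pow_orderOf_eq_one,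
    Units.val_one]

theorem mem_of_isUnit_mul_mem {P Q : AddSubgroup S} (hQP : Q ≤ P) {w : S} (hw : IsUnit w)
    (h : ∀ x ∈ P, w * x ∈ Q) {x : S} (hx : w * x ∈ P) : x ∈ P := by
  obtain ⟨k, hk⟩ := exists_pow_mul_eq_self_of_isUnit hw
  have key : ∀ n : ℕ, ∀ z ∈ P, w ^ n * z ∈ P := by
    intro n
    induction n with
    | zero => simp
    | succ n ih => exact fun z hz => by rw [pow_succ', mul_assoc]; exact hQP (h _ (ih z hz))
  simpa [← mul_assoc, hk] using key k _ hx

/-- In a finite ring the inverse of w is a power of w, and powers of w preserve P. -/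
theorem le_of_isUnit_mul_mem {P Q : AddSubgroup S} (hQP : Q ≤ P) {w : S} (hw : IsUnit w)
    (h : ∀ x ∈ P, w * x ∈ Q) : P ≤ Q := by
  intro x hx
  obtain ⟨k, hk⟩ := exists_pow_mul_eq_self_of_isUnit hw
  have key : ∀ n : ℕ, ∀ z ∈ P, w ^ n * z ∈ P := by
    intro n
    induction n with
    | zero => simp
    | succ n ih => exact fun z hz => by rw [pow_succ', mul_assoc]; exact hQP (h _ (ih z hz))
  have := h _ (key k x hx)
  rwa [← mul_assoc, mul_comm w, hk, one_mul] at this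

end LocalRing

/-! ### Ideals inside Q, in characteristic 3 and in characteristic 2 -/

/-- The properties shared by the projection `P` and the section `Q`, at one factor of a product of
rings, of the additive group of all translations in an elementary-normalized group. -/
structure IsTranslationPair {S : Type*} [CommRing S] (P Q : AddSubgroup S) : Prop where
  le : Q ≤ P
  sq_sub_one_mul_mem {x u v : S} : x ∈ P → u * v = 1 → (u ^ 2 - 1) * x ∈ Q
  central {x y a c u v w w' : S} : x ∈ P → a = 1 + x * y → a * c = 1 → u * v = 1 → w * w' = 1 →
    (w ^ 2 - 1) * ((u ^ 2 - 1) * x ^ 2 * y * c) ∈ Q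
  of_lower {x y a c u v : S} : x ∈ P → a = 1 + x * y → a * c = 1 → u * v = 1 →
    a * x * y ^ 2 * (1 - v ^ 2) ∈ Q → (u ^ 2 - 1) * x ^ 2 * y * c ∈ Q


namespace IsTranslationPair

variable {S : Type*} [CommRing S] {P Q : AddSubgroup S}

theorem isUnit_sq_mul_mem (h : IsTranslationPair P Q) {x u : S} (hx : x ∈ P) (hu : IsUnit u) :
    u ^ 2 * x ∈ P := by
  obtain ⟨v, huv⟩ := hu.exists_right_inv
  have := P.add_mem (h.le (h.sq_sub_one_mul_mem hx huv)) hx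
  convert this using 1
  ring

theorem natCard_quotient_span_dvd_index {x₀ : S} (hdvd : ∀ x ∈ P, x₀ ∣ x) :
    Nat.card (S ⧸ Ideal.span {x₀}) ∣ P.index := by
  rw [Ideal.natCard_quotient_eq_index]
  exact AddSubgroup.index_dvd_of_le fun x hx => Ideal.mem_span_singleton.2 (hdvd x hx)

theorem two_mul_natCard_quotient_dvd_index [Finite S] [CharP S 2] {x₀ z : S} (hdvd : ∀ x ∈ P, x₀ ∣ x)
    (hz : x₀ ∣ z) (hzP : z ∉ P) : 2 * Nat.card (S ⧸ Ideal.span {x₀}) ∣ P.index := by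
  have : Fact (Nat.Prime 2) := ⟨Nat.prime_two⟩
  have hle : P ≤ (Ideal.span {x₀}).toAddSubgroup :=
    fun x hx => Ideal.mem_span_singleton.2 (hdvd x hx)
  rw [← AddSubgroup.relIndex_mul_index hle, Ideal.natCard_quotient_eq_index]
  refine mul_dvd_mul_right ?_ _
  obtain ⟨n, hn⟩ := exists_natCard_eq_prime_pow (S := S) 2
  have hdiv : P.relIndex (Ideal.span {x₀}).toAddSubgroup ∣ 2 ^ n := by
    rw [← hn]
    exact (Dvd.intro _ (AddSubgroup.relIndex_mul_index hle)).trans (AddSubgroup.index_dvd_card _)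
  obtain ⟨j, -, hj⟩ := (Nat.dvd_prime_pow Nat.prime_two).1 hdiv
  rw [hj]
  refine dvd_pow_self 2 ?_
  rintro rfl
  rw [pow_zero, AddSubgroup.relIndex_eq_one] at hj
  exact hzP (hj (Ideal.mem_span_singleton.2 hz))

variable [IsLocalRing S]

section CharThree

variable [CharP S 3]

/-- In characteristic 3, r = (1 + r)² - (1 - r)². -/
theorem mul_mem_of_mem_maximalIdeal_char_three (h : IsTranslationPair P Q) {x r : S} (hx : x ∈ P)
    (hr : r ∈ IsLocalRing.maximalIdeal S) : r * x ∈ Q := by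
  have h3 : (3 : S) = 0 := by exact_mod_cast CharP.cast_eq_zero S 3
  obtain ⟨v, hv⟩ := (IsLocalRing.isUnit_add_of_mem isUnit_one hr).exists_right_inv
  obtain ⟨w, hw⟩ := (IsLocalRing.isUnit_add_of_mem isUnit_one (neg_mem hr)).exists_right_inv
  have := Q.sub_mem (h.sq_sub_one_mul_mem hx hv) (h.sq_sub_one_mul_mem hx hw)
  convert this using 1
  linear_combination (-r * x) * h3

/-- If z ± 1 are units, z = (z + 1)² - (z - 1)². If z ≡ 1 modulo the maximal ideal, split z = ζz +
(1 - ζ)z, where both summands fall under the first case; if z ≡ -1, use -z. -/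
theorem mul_mem_char_three (h : IsTranslationPair P Q) {ζ : S} (h0 : IsUnit ζ)
    (h1 : IsUnit (ζ - 1)) (h2 : IsUnit (ζ + 1)) {x : S} (hx : x ∈ P) (z : S) : z * x ∈ P := by
  have h3 : (3 : S) = 0 := by exact_mod_cast CharP.cast_eq_zero S 3
  have key : ∀ z : S, IsUnit (z + 1) → IsUnit (z - 1) → z * x ∈ P := by
    intro z hz hz'
    have := P.sub_mem (h.isUnit_sq_mul_mem hx hz) (h.isUnit_sq_mul_mem hx hz')
    convert this using 1
    linear_combination (-z * x) * h3
  have key' : ∀ z : S, z - 1 ∈ IsLocalRing.maximalIdeal S → z * x ∈ P := by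
    intro z hz
    have e1 : ζ * z * x ∈ P := by
      refine key _ ?_ ?_
      · convert IsLocalRing.isUnit_add_of_mem h2 (Ideal.mul_mem_left _ ζ hz) using 1
        ring
      · convert IsLocalRing.isUnit_add_of_mem h1 (Ideal.mul_mem_left _ ζ hz) using 1
        ring
    have e2 : (1 - ζ) * z * x ∈ P := by
      refine key _ ?_ ?_
      · convert IsLocalRing.isUnit_add_of_mem h2.neg (Ideal.mul_mem_left _ (1 - ζ) hz) using 1
        linear_combination h3
      · convert IsLocalRing.isUnit_add_of_mem h0.neg (Ideal.mul_mem_left _ (1 - ζ) hz) using 1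
        ring
    convert P.add_mem e1 e2 using 1
    ring
  by_cases hz : IsUnit (z - 1)
  · by_cases hz' : IsUnit (z + 1)
    · exact key z hz' hz
    · have : -z - 1 ∈ IsLocalRing.maximalIdeal S := by
        convert neg_mem (show z + 1 ∈ IsLocalRing.maximalIdeal S from hz') using 1
        ring
      convert P.neg_mem (key' _ this) using 1
      ring
  · exact key' z hz

variable [Finite S] [IsPrincipalIdealRing S]

theorem exists_ideal_char_three (h : IsTranslationPair P Q) :
    ∃ L : Ideal S, (∀ z ∈ L, z ∈ Q) ∧ Nat.card (S ⧸ L) ∣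
      (if Nat.card (S ⧸ IsLocalRing.maximalIdeal S) = 3 then 3 else 1) * P.index := by
  split_ifs with hk
  · obtain ⟨x₀, hx₀, hdvd⟩ := AddSubgroup.exists_mem_forall_dvd P
    obtain ⟨π, hπ⟩ := IsPrincipalIdealRing.principal (IsLocalRing.maximalIdeal S)
    have hπ' : IsLocalRing.maximalIdeal S = Ideal.span {π} := hπ
    refine ⟨Ideal.span {π * x₀}, fun z hz => ?_, ?_⟩
    · obtain ⟨s, rfl⟩ := Ideal.mem_span_singleton.1 hz
      have : s * π ∈ IsLocalRing.maximalIdeal S :=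
        Ideal.mul_mem_left _ _ (hπ' ▸ Ideal.mem_span_singleton_self π)
      convert h.mul_mem_of_mem_maximalIdeal_char_three hx₀ this using 1
      ring
    · refine (Ideal.natCard_quotient_span_mul_dvd _ _).trans (mul_dvd_mul ?_ ?_)
      · rw [← hk, hπ']
      · exact natCard_quotient_span_dvd_index hdvd
  · have : Fact (Nat.Prime 3) := ⟨Nat.prime_three⟩
    obtain ⟨n, hn⟩ := exists_natCard_eq_prime_pow (S := S) 3
    have hdiv : Nat.card (S ⧸ IsLocalRing.maximalIdeal S) ∣ 3 ^ n := by
      rw [← hn, Ideal.natCard_quotient_eq_index]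
      exact AddSubgroup.index_dvd_card _
    obtain ⟨j, -, hj⟩ := (Nat.dvd_prime_pow Nat.prime_three).1 hdiv
    have : Finite (S ⧸ IsLocalRing.maximalIdeal S) := Quotient.finite _
    have h1 : 1 < Nat.card (S ⧸ IsLocalRing.maximalIdeal S) := Finite.one_lt_card
    have h3 : 3 < Nat.card (S ⧸ IsLocalRing.maximalIdeal S) := by
      rw [hj] at hk h1 ⊢
      match j with
      | 0 => simp at h1
      | 1 => simp at hk
      | j + 2 => rw [pow_add]; have := Nat.one_le_pow j 3 (by norm_num); omega
    classical
    obtain ⟨ζ, hζ⟩ := IsLocalRing.exists_isUnit_sub ({0, 1, -1} : Finset S)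
      (Finset.card_le_three.trans_lt h3)
    have hζ0 : IsUnit ζ := by simpa using hζ 0 (by simp)
    have hζ1 : IsUnit (ζ - 1) := hζ 1 (by simp)
    have hζ2 : IsUnit (ζ + 1) := by simpa using hζ (-1) (by simp)
    have hPQ : P ≤ Q := by
      refine le_of_isUnit_mul_mem h.le (hζ1.mul hζ2) fun x hx => ?_
      obtain ⟨v, hv⟩ := hζ0.exists_right_inv
      convert h.sq_sub_one_mul_mem hx hv using 1
      ring
    let L : Ideal S :=
      { P with smul_mem' := fun z x hx => h.mul_mem_char_three hζ0 hζ1 hζ2 hx z }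
    refine ⟨L, fun z hz => hPQ hz, ?_⟩
    rw [Ideal.natCard_quotient_eq_index, one_mul]

end CharThree

section CharTwo

variable [CharP S 2]

theorem sq_mul_mem_of_mem_maximalIdeal (h : IsTranslationPair P Q) {x r : S} (hx : x ∈ P)
    (hr : r ∈ IsLocalRing.maximalIdeal S) : r ^ 2 * x ∈ Q := by
  have h2 : (2 : S) = 0 := by exact_mod_cast CharP.cast_eq_zero S 2
  obtain ⟨v, hv⟩ := (IsLocalRing.isUnit_add_of_mem isUnit_one hr).exists_right_inv
  convert h.sq_sub_one_mul_mem hx hv using 1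
  linear_combination (-r * x) * h2

/-- The choice y = t/(1 - xt) makes a = 1 + xy the inverse of 1 - xt and gives yc = t, so the
expression in `central` becomes linear in t. -/
theorem sq_mul_sq_mul_mem (h : IsTranslationPair P Q) {x r s t : S} (hx : x ∈ P)
    (hr : r ∈ IsLocalRing.maximalIdeal S) (hs : s ∈ IsLocalRing.maximalIdeal S)
    (ht : t ∈ IsLocalRing.maximalIdeal S) : s ^ 2 * (r ^ 2 * x ^ 2 * t) ∈ Q := by
  have h2 : (2 : S) = 0 := by exact_mod_cast CharP.cast_eq_zero S 2
  obtain ⟨v, hv⟩ := (IsLocalRing.isUnit_add_of_mem isUnit_one hr).exists_right_inv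
  obtain ⟨w, hw⟩ := (IsLocalRing.isUnit_add_of_mem isUnit_one hs).exists_right_inv
  obtain ⟨a, ha⟩ := (IsLocalRing.isUnit_add_of_mem isUnit_one
    (neg_mem (Ideal.mul_mem_left _ x ht))).exists_left_inv
  have := h.central (y := t * a) hx (by linear_combination ha) ha hv hw
  convert this using 1
  have e : t * a * (1 + -(x * t)) = t := by linear_combination t * ha
  rw [mul_assoc _ (t * a), e]
  linear_combination (-(r * x ^ 2 * t * s ^ 2) - s * r ^ 2 * x ^ 2 * t - 2 * r * s * x ^ 2 * t) * h2

/-- This removes the factor s² by using `of_lower` in place of `central`. With v = 1/(1 + r) one has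
1 - v² = (vr)², so the lower entry is (yvr)²x + y²(vr)²x²y, and both terms are already known to lie
in Q. -/
theorem sq_mul_sq_mul_mem' (h : IsTranslationPair P Q) {x r t : S} (hx : x ∈ P)
    (hr : r ∈ IsLocalRing.maximalIdeal S) (ht : t ∈ IsLocalRing.maximalIdeal S) :
    r ^ 2 * x ^ 2 * t ∈ Q := by
  have h2 : (2 : S) = 0 := by exact_mod_cast CharP.cast_eq_zero S 2
  obtain ⟨v, hv⟩ := (IsLocalRing.isUnit_add_of_mem isUnit_one hr).exists_right_inv
  obtain ⟨a, ha⟩ := (IsLocalRing.isUnit_add_of_mem isUnit_one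
    (neg_mem (Ideal.mul_mem_left _ x ht))).exists_left_inv
  have e : t * a * (1 + -(x * t)) = t := by linear_combination t * ha
  have hy : t * a ∈ IsLocalRing.maximalIdeal S := Ideal.mul_mem_right _ _ ht
  have hvr : v * r ∈ IsLocalRing.maximalIdeal S := Ideal.mul_mem_left _ _ hr
  have := h.of_lower (y := t * a) hx (by linear_combination ha) ha hv ?_
  · convert this using 1
    rw [mul_assoc _ (t * a), e]
    linear_combination (-(r * x ^ 2 * t)) * h2
  · have e1 := h.sq_mul_mem_of_mem_maximalIdeal hx (Ideal.mul_mem_right (v * r) _ hy)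
    have e2 := h.sq_mul_sq_mul_mem hx hvr hy hy
    convert Q.add_mem e1 e2 using 1
    have ea : a = 1 + x * (t * a) := by linear_combination ha
    have ev : 1 - v ^ 2 = (v * r) ^ 2 := by
      linear_combination (-1 - v * (1 + r)) * hv + v ^ 2 * r * h2
    rw [ev]
    generalize t * a = y at *
    rw [ea]
    ring

/-- If 1 - xs is a unit, `central` gives the element up to the unit (ζ² - 1)², which is cancelled by
finiteness. Otherwise split s = ζs + (1 - ζ)s, and both parts satisfy the unit condition. -/
theorem sq_mul_mem_char_two (h : IsTranslationPair P Q) [Finite S] {ζ : S} (h0 : IsUnit ζ)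
    (h1 : IsUnit (ζ - 1)) {x : S} (hx : x ∈ P) (s : S) : x ^ 2 * s ∈ P := by
  have h2 : (2 : S) = 0 := by exact_mod_cast CharP.cast_eq_zero S 2
  obtain ⟨ξ, hξ⟩ := h0.exists_right_inv
  have hw : IsUnit (ζ ^ 2 - 1) := by
    convert h1.pow 2 using 1
    linear_combination (ζ - 1) * h2
  have hwP : ∀ x ∈ P, (ζ ^ 2 - 1) * x ∈ Q := fun x hx => h.sq_sub_one_mul_mem hx hξ
  have key : ∀ s : S, IsUnit (1 - x * s) → x ^ 2 * s ∈ P := by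
    intro s hs
    obtain ⟨a, ha⟩ := hs.exists_left_inv
    refine mem_of_isUnit_mul_mem h.le hw hwP (mem_of_isUnit_mul_mem h.le hw hwP ?_)
    convert h.le (h.central (y := s * a) hx (by linear_combination ha) ha hξ hξ) using 1
    linear_combination (-(ζ ^ 2 - 1) ^ 2 * x ^ 2 * s) * ha
  by_cases hs : IsUnit (1 - x * s)
  · exact key s hs
  · have e1 : x ^ 2 * (ζ * s) ∈ P := by
      refine key _ ?_
      convert IsLocalRing.isUnit_add_of_mem h1.neg (Ideal.mul_mem_left _ ζ hs) using 1
      ring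
    have e2 : x ^ 2 * ((1 - ζ) * s) ∈ P := by
      refine key _ ?_
      convert IsLocalRing.isUnit_add_of_mem h0 (Ideal.mul_mem_left _ (1 - ζ) hs) using 1
      ring
    convert P.add_mem e1 e2 using 1
    ring

variable [Finite S] [IsPrincipalIdealRing S]

theorem exists_ideal_char_two (h : IsTranslationPair P Q) :
    ∃ L : Ideal S, (∀ z ∈ L, z ∈ Q) ∧ Nat.card (S ⧸ L) ∣
      (if Nat.card (S ⧸ IsLocalRing.maximalIdeal S) = 2 then 4 else 1) * P.index ^ 2 := by
  have h2 : (2 : S) = 0 := by exact_mod_cast CharP.cast_eq_zero S 2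
  obtain ⟨x₀, hx₀, hdvd⟩ := AddSubgroup.exists_mem_forall_dvd P
  have hx₀P := natCard_quotient_span_dvd_index hdvd
  split_ifs with hk
  · obtain ⟨π, hπ⟩ := IsPrincipalIdealRing.principal (IsLocalRing.maximalIdeal S)
    have hπ' : IsLocalRing.maximalIdeal S = Ideal.span {π} := hπ
    have hπm : π ∈ IsLocalRing.maximalIdeal S := hπ' ▸ Ideal.mem_span_singleton_self π
    rw [hπ'] at hk
    -- If P is the whole ideal generated by x₀, then π²x₀ generates a suitable ideal. If not, the
    -- index of P gains a factor 2, which pays for the weaker generator π³x₀².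
    by_cases hP : ∀ z, x₀ ∣ z → z ∈ P
    · refine ⟨Ideal.span {π * (π * x₀)}, fun z hz => ?_, ?_⟩
      · obtain ⟨s, rfl⟩ := Ideal.mem_span_singleton.1 hz
        convert h.sq_mul_mem_of_mem_maximalIdeal (hP _ (dvd_mul_right x₀ s)) hπm using 1
        ring
      · refine (Ideal.natCard_quotient_span_mul_dvd _ _).trans ?_
        refine (mul_dvd_mul_left _ (Ideal.natCard_quotient_span_mul_dvd _ _)).trans ?_
        rw [hk, ← mul_assoc]
        exact mul_dvd_mul_left _ (hx₀P.trans (dvd_pow_self _ two_ne_zero))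
    · push Not at hP
      obtain ⟨z, hz, hzP⟩ := hP
      refine ⟨Ideal.span {π * (π * (π * (x₀ * x₀)))}, fun z hz => ?_, ?_⟩
      · obtain ⟨s, rfl⟩ := Ideal.mem_span_singleton.1 hz
        convert h.sq_mul_sq_mul_mem' hx₀ hπm (Ideal.mul_mem_left _ s hπm) using 1
        ring
      · have hd := pow_dvd_pow_of_dvd (two_mul_natCard_quotient_dvd_index hdvd hz hzP) 2
        refine (Ideal.natCard_quotient_span_mul_dvd _ _).trans ?_
        refine (mul_dvd_mul_left _ (Ideal.natCard_quotient_span_mul_dvd _ _)).trans ?_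
        refine (mul_dvd_mul_left _ (mul_dvd_mul_left _
          (Ideal.natCard_quotient_span_mul_dvd _ _))).trans ?_
        refine (mul_dvd_mul_left _ (mul_dvd_mul_left _ (mul_dvd_mul_left _
          (Ideal.natCard_quotient_span_mul_dvd _ _)))).trans ?_
        rw [hk]
        refine dvd_trans ?_ (mul_dvd_mul_left 4 hd)
        -- Three factors π cost 8, while 4 · 2² = 16 is available.
        exact ⟨2, by ring⟩
  · have : Finite (S ⧸ IsLocalRing.maximalIdeal S) := Quotient.finite _
    have h1 : 1 < Nat.card (S ⧸ IsLocalRing.maximalIdeal S) := Finite.one_lt_card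
    classical
    obtain ⟨ζ, hζ⟩ := IsLocalRing.exists_isUnit_sub ({0, 1} : Finset S)
      (Finset.card_le_two.trans_lt (by omega))
    have hζ0 : IsUnit ζ := by simpa using hζ 0 (by simp)
    have hζ1 : IsUnit (ζ - 1) := hζ 1 (by simp)
    have hPQ : P ≤ Q := by
      refine le_of_isUnit_mul_mem h.le (hζ1.pow 2) fun x hx => ?_
      obtain ⟨v, hv⟩ := hζ0.exists_right_inv
      convert h.sq_sub_one_mul_mem hx hv using 1
      linear_combination (-x * (ζ - 1)) * h2
    refine ⟨Ideal.span {x₀ * x₀}, fun z hz => hPQ ?_, ?_⟩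
    · obtain ⟨s, rfl⟩ := Ideal.mem_span_singleton.1 hz
      rw [← pow_two]
      exact h.sq_mul_mem_char_two hζ0 hζ1 hx₀ s
    · rw [one_mul, pow_two]
      exact (Ideal.natCard_quotient_span_mul_dvd _ _).trans (mul_dvd_mul hx₀P hx₀P)

end CharTwo

end IsTranslationPair

/-! ### Passing from a product of rings to one factor -/

section Product

variable {ι : Type*}

theorem AddSubgroup.index_pi_univ [Fintype ι] {S : ι → Type*} [∀ i, AddCommGroup (S i)]
    (H : ∀ i, AddSubgroup (S i)) : (AddSubgroup.pi Set.univ H).index = ∏ i, (H i).index := by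
  let g : (∀ i, S i) →+ ∀ i, S i ⧸ H i :=
    AddMonoidHom.pi fun i => (QuotientAddGroup.mk' (H i)).comp (Pi.evalAddMonoidHom S i)
  have hg : g.ker = AddSubgroup.pi Set.univ H := by
    ext x
    rw [AddMonoidHom.mem_ker, AddSubgroup.mem_pi, funext_iff]
    exact forall_congr' fun i => (QuotientAddGroup.eq_zero_iff (x i)).trans (by simp)
  have hsurj : Function.Surjective g := fun y => by
    choose x hx using fun i => QuotientAddGroup.mk'_surjective (H i) (y i)
    exact ⟨x, funext hx⟩
  rw [← hg, AddSubgroup.index_ker, AddMonoidHom.range_eq_top.2 hsurj, AddSubgroup.card_top,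
    Nat.card_pi]
  rfl

variable [DecidableEq ι] {S : ι → Type*} [∀ i, CommRing (S i)]

theorem Pi.mulSingle_eq_one_add_mul_single {i : ι} {x : ∀ i, S i} {y a : S i}
    (ha : a = 1 + x i * y) : Pi.mulSingle i a = 1 + x * Pi.single i y := by
  ext j
  by_cases hj : j = i
  · subst hj; simp [ha]
  · simp [hj]

theorem Pi.mulSingle_mul_mulSingle_eq_one {i : ι} {u v : S i} (h : u * v = 1) :
    (Pi.mulSingle i u * Pi.mulSingle i v : ∀ i, S i) = 1 := by
  rw [← Pi.mulSingle_mul, h, Pi.mulSingle_one]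

/-- Units and parameters at one factor are extended by 1 and 0 elsewhere, so the matrix identities
over the product yield elements supported at i, that is, elements of the section. -/
theorem ElementaryNormalized.isTranslationPair
    {N : Subgroup (Matrix.SpecialLinearGroup (Fin 2) (∀ i, S i))} (hN : ElementaryNormalized N)
    (i : ι) : IsTranslationPair ((translationKernel N).map (Pi.evalAddMonoidHom S i))
      ((translationKernel N).comap (AddMonoidHom.single S i)) where
  le z hz := ⟨Pi.single i z, hz, by simp⟩
  sq_sub_one_mul_mem := by
    rintro _ u v ⟨x, hx, rfl⟩ huv
    have := (translationKernel N).sub_mem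
      (hN.translation_sq_mul_mem (Pi.mulSingle_mul_mulSingle_eq_one (S := S) huv) hx) hx
    rw [AddSubgroup.mem_comap]
    convert this using 1
    ext j
    by_cases hj : j = i
    · subst hj; simp [sub_mul]
    · simp [hj]
  central := by
    rintro _ y a c u v w w' ⟨x, hx, rfl⟩ ha hc huv hw
    have := neg_mem (show _ ∈ translationKernel N from
      hN.central (hN.lower_mul_upper_mem hx (Pi.mulSingle_eq_one_add_mul_single (S := S) ha)
      (Pi.mulSingle_mul_mulSingle_eq_one hc) (Pi.mulSingle_mul_mulSingle_eq_one huv))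
      (Pi.mulSingle_mul_mulSingle_eq_one hw))
    rw [AddSubgroup.mem_comap]
    convert this using 1
    ext j
    by_cases hj : j = i
    · subst hj; simp
    · simp [hj]
  of_lower := by
    rintro _ y a c u v ⟨x, hx, rfl⟩ ha hc huv hlow
    have h1 := hN.lower_mul_upper_mem hx (Pi.mulSingle_eq_one_add_mul_single (S := S) ha)
      (Pi.mulSingle_mul_mulSingle_eq_one hc) (Pi.mulSingle_mul_mulSingle_eq_one huv)
    have h2 : lowerTranslation (Pi.mulSingle i a * x * Pi.single i y ^ 2 *
        (1 - Pi.mulSingle i v ^ 2)) ∈ N := by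
      refine hN.lowerTranslation_mem ?_
      convert mem_translationKernel.1 (AddSubgroup.mem_comap.1 hlow) using 2
      ext j
      by_cases hj : j = i
      · subst hj; simp
      · simp [hj]
    have := neg_mem (show _ ∈ translationKernel N from (Subgroup.mul_mem_cancel_left N h2).1 h1)
    rw [AddSubgroup.mem_comap]
    convert this using 1
    ext j
    by_cases hj : j = i
    · subst hj; simp
    · simp [hj]

end Product

/-! ### Quotients by powers of a maximal ideal -/

section PrimePower

variable {D : Type*} [CommRing D] {P : Ideal D} [P.IsMaximal] {n : ℕ}

theorem Ideal.comap_mk_pow_eq_of_isMaximal {M : Ideal (D ⧸ P ^ n)} (hM : M.IsMaximal) :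
    M.comap (Ideal.Quotient.mk (P ^ n)) = P := by
  have hprime : (M.comap (Ideal.Quotient.mk (P ^ n))).IsPrime := Ideal.IsPrime.comap _
  have hle : P ^ n ≤ M.comap (Ideal.Quotient.mk (P ^ n)) := by
    intro x hx
    rw [Ideal.mem_comap, Ideal.Quotient.eq_zero_iff_mem.2 hx]
    exact zero_mem _
  exact (Ideal.IsMaximal.eq_of_le ‹_› hprime.ne_top (Ideal.IsPrime.le_of_pow_le hle)).symm

theorem Ideal.isLocalRing_quotient_pow (hn : n ≠ 0) : IsLocalRing (D ⧸ P ^ n) := by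
  have hne : P ^ n ≠ ⊤ := fun h => Ideal.IsMaximal.ne_top ‹_›
    (top_le_iff.1 (h ▸ Ideal.pow_le_self hn))
  have : Nontrivial (D ⧸ P ^ n) := Ideal.Quotient.nontrivial_iff.2 hne
  obtain ⟨M, hM⟩ := Ideal.exists_maximal (D ⧸ P ^ n)
  refine IsLocalRing.of_unique_max_ideal ⟨M, hM, fun M' hM' => ?_⟩
  refine Ideal.comap_injective_of_surjective _ (Ideal.Quotient.mk_surjective (I := P ^ n)) ?_
  rw [Ideal.comap_mk_pow_eq_of_isMaximal hM, Ideal.comap_mk_pow_eq_of_isMaximal hM']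

theorem Ideal.natCard_quotient_maximalIdeal_quotient_pow [IsLocalRing (D ⧸ P ^ n)] :
    Nat.card ((D ⧸ P ^ n) ⧸ IsLocalRing.maximalIdeal (D ⧸ P ^ n)) = Nat.card (D ⧸ P) := by
  have h := Ideal.comap_mk_pow_eq_of_isMaximal
    (IsLocalRing.maximalIdeal.isMaximal (D ⧸ P ^ n))
  rw [Ideal.natCard_quotient_eq_index, Ideal.natCard_quotient_eq_index]
  conv_rhs => rw [← h]
  exact (AddSubgroup.index_comap_of_surjective
    (f := (Ideal.Quotient.mk (P ^ n) : D →+ D ⧸ P ^ n)) _ Ideal.Quotient.mk_surjective).symm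

theorem IsDedekindDomain.isPrincipalIdealRing_quotient {D : Type*} [CommRing D]
    [IsDedekindDomain D] {I : Ideal D} (hI : I ≠ ⊥) : IsPrincipalIdealRing (D ⧸ I) where
  principal J := by
    have hle : I ≤ J.comap (Ideal.Quotient.mk I) := by
      intro x hx
      rw [Ideal.mem_comap, Ideal.Quotient.eq_zero_iff_mem.2 hx]
      exact zero_mem _
    obtain ⟨a, ha⟩ := IsDedekindDomain.exists_sup_span_eq hle hI
    refine ⟨Ideal.Quotient.mk I a, ?_⟩
    have := congrArg (Ideal.map (Ideal.Quotient.mk I)) ha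
    rw [Ideal.map_comap_of_surjective _ Ideal.Quotient.mk_surjective, Ideal.map_sup,
      Ideal.map_quotient_self, bot_sup_eq, Ideal.map_span, Set.image_singleton] at this
    exact this.symm

end PrimePower

/-! ### Reduction modulo an ideal -/

section Surjection

variable {D A : Type*} [CommRing D] [CommRing A] {φ : D →+* A}

theorem Matrix.SpecialLinearGroup.map_translation (r : D) :
    Matrix.SpecialLinearGroup.map φ (translation r) = translation (φ r) := by
  ext i j
  fin_cases i <;> fin_cases j <;> simp [coe_translation]

theorem Matrix.SpecialLinearGroup.map_lowerTranslation (r : D) :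
    Matrix.SpecialLinearGroup.map φ (lowerTranslation r) = lowerTranslation (φ r) := by
  ext i j
  fin_cases i <;> fin_cases j <;> simp [coe_lowerTranslation]

variable (N : Subgroup (Matrix.SpecialLinearGroup (Fin 2) D))

/-- Elementary matrices lift entrywise along φ, so surjectivity of SL₂ under reduction is not
needed. -/
theorem elementaryNormalized_map [N.Normal] (hφ : Function.Surjective φ) :
    ElementaryNormalized (N.map (Matrix.SpecialLinearGroup.map (n := Fin 2) φ)) := by
  have h : ∀ g, Matrix.SpecialLinearGroup.map φ g ∈ Subgroup.normalizer
      (N.map (Matrix.SpecialLinearGroup.map (n := Fin 2) φ) :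
        Set (Matrix.SpecialLinearGroup (Fin 2) A)) := fun g =>
    Subgroup.le_normalizer_map _
      (Subgroup.mem_map_of_mem _ (by rw [Subgroup.normalizer_eq_top]; exact Subgroup.mem_top g))
  constructor
  · intro x
    obtain ⟨r, rfl⟩ := hφ x
    rw [← Matrix.SpecialLinearGroup.map_translation]
    exact h _
  · intro x
    obtain ⟨r, rfl⟩ := hφ x
    rw [← Matrix.SpecialLinearGroup.map_lowerTranslation]
    exact h _

theorem comap_translationKernel_map
    (hker : (Matrix.SpecialLinearGroup.map (n := Fin 2) φ).ker ≤ N) :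
    (translationKernel (N.map (Matrix.SpecialLinearGroup.map (n := Fin 2) φ))).comap
      (φ : D →+ A) = translationKernel N := by
  ext r
  have h := Subgroup.comap_map_eq_self hker
  rw [AddSubgroup.mem_comap, mem_translationKernel, mem_translationKernel, ← h,
    Subgroup.mem_comap, Matrix.SpecialLinearGroup.map_translation, h]
  rfl

theorem map_ker_eq_principalCongruenceSubgroup (q : Ideal D) (hq : RingHom.ker φ = q) :
    (Matrix.SpecialLinearGroup.map (n := Fin 2) φ).ker = principalCongruenceSubgroup q := by
  ext X
  rw [principalCongruenceSubgroup, MonoidHom.mem_ker, MonoidHom.mem_ker,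
    Matrix.SpecialLinearGroup.ext_iff, Matrix.SpecialLinearGroup.ext_iff]
  refine forall_congr' fun i => forall_congr' fun j => ?_
  have h : ∀ a b : D, φ a = φ b ↔ Ideal.Quotient.mk q a = Ideal.Quotient.mk q b := fun a b => by
    rw [Ideal.Quotient.mk_eq_mk_iff_sub_mem, ← hq, RingHom.sub_mem_ker_iff]
  have := h (X i j) ((1 : Matrix (Fin 2) (Fin 2) D) i j)
  simpa [Matrix.one_apply, apply_ite] using this

end Surjection

/-! ### From local bounds to the level -/

section Dedekind

universe u

theorem natCard_quotient_level_dvd {D : Type u} [CommRing D] [IsDedekindDomain D]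
    [Ring.HasFiniteQuotients D] (p c k : ℕ) (hp : p.Prime) [CharP D p]
    (hloc : ∀ (S : Type u) [CommRing S] [IsLocalRing S] [Finite S] [IsPrincipalIdealRing S]
      [CharP S p] (P Q : AddSubgroup S), IsTranslationPair P Q →
        ∃ L : Ideal S, (∀ z ∈ L, z ∈ Q) ∧ Nat.card (S ⧸ L) ∣
          (if Nat.card (S ⧸ IsLocalRing.maximalIdeal S) = p then c else 1) * P.index ^ k)
    (hfin : (primesOfResidueCard D p).Finite)
    (N : Subgroup (Matrix.SpecialLinearGroup (Fin 2) D)) [N.Normal]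
    (hN : IsCongruenceSubgroup N) :
    Nat.card (D ⧸ level N) ∣ c ^ (primesOfResidueCard D p).ncard * N.index ^ k := by
  classical
  obtain ⟨q, hq, hqN⟩ := hN
  let ι := (UniqueFactorizationMonoid.factors q).toFinset
  let e : ι → ℕ := fun i => Multiset.count (i : Ideal D) (UniqueFactorizationMonoid.factors q)
  let S : ι → Type u := fun i => D ⧸ (i : Ideal D) ^ e i
  have hprime : ∀ i : ι, Prime (i : Ideal D) := fun i =>
    UniqueFactorizationMonoid.prime_of_factor _ (Multiset.mem_toFinset.1 i.2)
  have hmax : ∀ i : ι, (i : Ideal D).IsMaximal := fun i =>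
    (Ideal.isPrime_of_prime (hprime i)).isMaximal (hprime i).ne_zero
  have he : ∀ i : ι, e i ≠ 0 := fun i =>
    (Multiset.count_pos.2 (Multiset.mem_toFinset.1 i.2)).ne'
  have hpow : ∀ i : ι, (i : Ideal D) ^ e i ≠ ⊥ := fun i => pow_ne_zero _ (hprime i).ne_zero
  have hlocal : ∀ i, IsLocalRing (S i) := fun i => Ideal.isLocalRing_quotient_pow (he i)
  have hfinite : ∀ i, Finite (S i) := fun i => Ring.HasFiniteQuotients.finiteQuotient (hpow i)
  have hpir : ∀ i, IsPrincipalIdealRing (S i) := fun i =>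
    IsDedekindDomain.isPrincipalIdealRing_quotient (hpow i)
  have hchar : ∀ i, CharP (S i) p := fun i => by
    rw [CharP.charP_iff_prime_eq_zero hp, ← map_natCast (Ideal.Quotient.mk _),
      CharP.cast_eq_zero D p, map_zero]
  let φ : D →+* ∀ i, S i :=
    (IsDedekindDomain.quotientEquivPiFactors hq).toRingHom.comp (Ideal.Quotient.mk q)
  have hφ : Function.Surjective φ :=
    (IsDedekindDomain.quotientEquivPiFactors hq).surjective.comp Ideal.Quotient.mk_surjective
  have hker : RingHom.ker φ = q := by
    ext x
    rw [RingHom.mem_ker, ← Ideal.Quotient.eq_zero_iff_mem]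
    exact (IsDedekindDomain.quotientEquivPiFactors hq).map_eq_zero_iff (x := Ideal.Quotient.mk q x)
  have hkerN : (Matrix.SpecialLinearGroup.map (n := Fin 2) φ).ker ≤ N := by
    rwa [map_ker_eq_principalCongruenceSubgroup q hker]
  let b := translationKernel (N.map (Matrix.SpecialLinearGroup.map (n := Fin 2) φ))
  have hb : b.comap (φ : D →+ ∀ i, S i) = translationKernel N :=
    comap_translationKernel_map N hkerN
  have hpair := (elementaryNormalized_map N hφ).isTranslationPair (S := S)
  choose L hLQ hLcard using fun i => hloc (S i) _ _ (hpair i)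
  have hindex : ∏ i, (b.map (Pi.evalAddMonoidHom S i)).index ∣ N.index := by
    rw [← AddSubgroup.index_pi_univ]
    refine dvd_trans ?_ (index_translationKernel_dvd (N := N))
    rw [← hb, AddSubgroup.index_comap_of_surjective (f := (φ : D →+ ∀ i, S i)) _ hφ]
    exact AddSubgroup.index_dvd_of_le fun x hx i _ => ⟨x, hx, rfl⟩
  -- J pulls back the product of the local ideals. It lies in the level because φ r is the sum of
  -- its one-factor components, each in the corresponding section.
  let J : Ideal D := (Ideal.pi L).comap φ
  have hJcard : Nat.card (D ⧸ J) = ∏ i, Nat.card (S i ⧸ L i) := by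
    have h := AddSubgroup.index_comap_of_surjective (f := (φ : D →+ ∀ i, S i))
      (AddSubgroup.pi Set.univ fun i => (L i).toAddSubgroup) hφ
    rw [AddSubgroup.index_pi_univ] at h
    rw [Ideal.natCard_quotient_eq_index, ← Finset.prod_congr rfl fun i _ =>
      (Ideal.natCard_quotient_eq_index (L i)).symm, ← h]
    congr 1
    ext x
    simp [J, AddSubgroup.mem_pi, Ideal.mem_pi]
  have hJ : J ≤ level N := by
    refine (isGreatest_level N).2 ((NE2_le_iff _ _).2 fun r hr => ?_)
    rw [Subgroup.normalCore_eq_self, ← mem_translationKernel, ← hb, AddSubgroup.mem_comap]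
    have hsum : φ r = ∑ i, Pi.single i (φ r i) := (Finset.univ_sum_single _).symm
    change φ r ∈ b
    rw [hsum]
    exact sum_mem fun i _ => hLQ i _ (hr i)
  have hcount : ∏ i : ι, (if Nat.card (D ⧸ (i : Ideal D)) = p then c else 1) ∣
      c ^ (primesOfResidueCard D p).ncard := by
    rw [Finset.prod_ite, Finset.prod_const, Finset.prod_const_one, mul_one]
    refine pow_dvd_pow _ ?_
    rw [← Set.ncard_coe_finset]
    refine Set.ncard_le_ncard_of_injOn (fun i : ι => (i : Ideal D)) (fun i hi => ?_)
      Subtype.val_injective.injOn hfin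
    exact ⟨(hmax i).isPrime, by simpa using hi⟩
  have h1 : Nat.card (D ⧸ level N) ∣ Nat.card (D ⧸ J) := by
    rw [Ideal.natCard_quotient_eq_index, Ideal.natCard_quotient_eq_index]
    exact AddSubgroup.index_dvd_of_le hJ
  refine h1.trans ?_
  rw [hJcard]
  refine (Finset.prod_dvd_prod_of_dvd _ _ fun i _ => hLcard i).trans ?_
  rw [Finset.prod_mul_distrib, Finset.prod_pow]
  refine mul_dvd_mul ?_ (pow_dvd_pow_of_dvd hindex k)
  refine (dvd_of_eq (Finset.prod_congr rfl fun i _ => ?_)).trans hcount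
  rw [Ideal.natCard_quotient_maximalIdeal_quotient_pow]

theorem IsCongruenceSubgroup.finiteIndex {D : Type*} [CommRing D] [Ring.HasFiniteQuotients D]
    {N : Subgroup (Matrix.SpecialLinearGroup (Fin 2) D)} (hN : IsCongruenceSubgroup N) :
    N.FiniteIndex := by
  obtain ⟨q, hq, hqN⟩ := hN
  have : Finite (D ⧸ q) := Ring.HasFiniteQuotients.finiteQuotient hq
  have : Finite (Matrix.SpecialLinearGroup (Fin 2) (D ⧸ q)) := Subtype.finite
  have : (principalCongruenceSubgroup q).FiniteIndex := Subgroup.finiteIndex_ker _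
  exact Subgroup.finiteIndex_of_le hqN

theorem finite_primesOfResidueCard (D : Type*) [CommRing D] [Ring.HasFiniteQuotients D] (n : ℕ) :
    (primesOfResidueCard D n).Finite :=
  (Ring.HasFiniteQuotients.finite_cardQuot_le n).subset fun p hp => by
    rw [Set.mem_ofPred_eq, Submodule.cardQuot_apply]
    exact hp.2.le

end Dedekind

/-! ### The ring of S-integers is Dedekind with finite quotients -/

section FunctionField

theorem SIntegers.mem_of_isIntegral {K : Type*} [Field K] {S : Set (Place K)} {x : K}
    (hx : IsIntegral (SIntegers S) x) : x ∈ SIntegers S := by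
  rw [mem_SIntegers]
  intro v hv
  obtain ⟨p, hp, hpx⟩ := hx
  have hle : SIntegers S ≤ v.1.toSubring := fun y hy => mem_SIntegers.1 hy v hv
  have hint : IsIntegral v.1 x := by
    refine ⟨p.map (Subring.inclusion hle), hp.map _, ?_⟩
    rw [Polynomial.eval₂_map]
    exact hpx
  obtain ⟨y, rfl⟩ := IsIntegrallyClosed.algebraMap_eq_of_integral hint
  exact y.2

theorem Subring.isIntegrallyClosed_of_forall_isIntegral {K : Type*} [Field K] (D : Subring K)
    (h : ∀ x : K, IsIntegral D x → x ∈ D) : IsIntegrallyClosed D := by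
  rw [isIntegrallyClosed_iff (FractionRing D)]
  intro x hx
  let f : FractionRing D →ₐ[D] K := IsFractionRing.liftAlgHom (g := Algebra.ofId D K)
    Subtype.val_injective
  refine ⟨⟨f x, h _ (hx.map f)⟩, ?_⟩
  apply f.toRingHom.injective
  exact f.commutes _

/-- Reducing the relation modulo x kills all constant terms; then divide by x and repeat. -/
theorem exists_pow_dvd_of_linearIndependent_quotient {F D : Type*} [Field F] [CommRing D] [IsDomain D]
    [Algebra F D] {x : D} (hx : x ≠ 0) {ι : Type*} [Fintype ι] (d : ι → D)
    (hd : LinearIndependent F fun i => Ideal.Quotient.mk (Ideal.span {x}) (d i)) (n : ℕ)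
    (p : ι → Polynomial F) (hp : ∑ i, Polynomial.aeval x (p i) * d i = 0) (i : ι) :
    Polynomial.X ^ n ∣ p i := by
  induction n generalizing p i with
  | zero => simp
  | succ n ih =>
    have hmk : ∀ f : Polynomial F, Ideal.Quotient.mk (Ideal.span {x}) (Polynomial.aeval x f) =
        algebraMap F _ (f.coeff 0) := by
      intro f
      conv_lhs => rw [← Polynomial.X_mul_divX_add f]
      rw [map_add, map_mul, Polynomial.aeval_X, Polynomial.aeval_C, map_add, map_mul,
        Ideal.Quotient.eq_zero_iff_mem.2 (Ideal.mem_span_singleton_self x), zero_mul, zero_add]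
      rfl
    have h0 : ∀ i, (p i).coeff 0 = 0 := by
      refine Fintype.linearIndependent_iff.1 hd (fun i => (p i).coeff 0) ?_
      have := congrArg (Ideal.Quotient.mk (Ideal.span {x})) hp
      rw [map_sum, map_zero] at this
      rw [← this]
      refine Finset.sum_congr rfl fun i _ => ?_
      rw [map_mul, hmk, Algebra.smul_def]
    have hX : ∀ i, p i = Polynomial.X * (p i).divX := fun i => by
      conv_lhs => rw [← Polynomial.X_mul_divX_add (p i), h0 i, map_zero, add_zero]
    have hsum : ∑ i, Polynomial.aeval x (p i).divX * d i = 0 := by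
      refine (mul_eq_zero.1 ?_).resolve_left hx
      rw [Finset.mul_sum, ← hp]
      refine Finset.sum_congr rfl fun i _ => ?_
      conv_rhs => rw [hX i, map_mul, Polynomial.aeval_X, mul_assoc]
    rw [hX i, pow_succ']
    exact mul_dvd_mul_left _ (ih (fun i => (p i).divX) hsum i)

open scoped IntermediateField.algebraAdjoinAdjoin in
theorem finite_quotient_span_of_transcendental {F K : Type*} [Field F] [Finite F] [Field K]
    [Algebra F K] (D : Subring K) [Algebra F D] [IsScalarTower F D K] (x : D)
    (hx : Transcendental F (x : K)) [FiniteDimensional (IntermediateField.adjoin F {(x : K)}) K] :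
    Finite (D ⧸ Ideal.span {x}) := by
  have hx0 : x ≠ 0 := by
    rintro rfl
    exact hx isAlgebraic_zero
  have hrank : Module.rank F (D ⧸ Ideal.span {x}) ≤
      Module.finrank (IntermediateField.adjoin F {(x : K)}) K := by
    -- Lifts of independent elements stay independent over F[x], hence over F(x), so [K : F(x)]
    -- bounds the dimension of the quotient.
    refine rank_le fun s hs => ?_
    choose d hd using fun i : s => Ideal.Quotient.mk_surjective (i : D ⧸ Ideal.span {x})
    have hs' : LinearIndependent F fun i => Ideal.Quotient.mk (Ideal.span {x}) (d i) := by
      simpa only [hd] using hs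
    have hli : LinearIndependent (Algebra.adjoin F {(x : K)}) fun i => (d i : K) := by
      rw [Fintype.linearIndependent_iff]
      intro g hg i
      have hadj : ∀ a : Algebra.adjoin F {(x : K)}, ∃ f : Polynomial F,
          Polynomial.aeval (x : K) f = a := fun a =>
        (Algebra.adjoin_singleton_eq_range_aeval F (x : K)).le a.2
      choose f hf using fun i => hadj (g i)
      have hsum : ∑ i, Polynomial.aeval x (f i) * d i = 0 := by
        apply Subtype.val_injective
        rw [← hg.trans (ZeroMemClass.coe_zero D).symm]
        rw [AddSubmonoidClass.coe_finsetSum]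
        refine Finset.sum_congr rfl fun i _ => ?_
        rw [Algebra.smul_def, show algebraMap (Algebra.adjoin F {(x : K)}) K (g i) = g i from rfl,
          ← hf i]
        exact congrArg (· * (d i : K)) (Polynomial.aeval_algebraMap_apply K x (f i)).symm
      have hf0 : f i = 0 := by
        by_contra hne
        have h1 := exists_pow_dvd_of_linearIndependent_quotient hx0 d hs' ((f i).natDegree + 1) f hsum i
        have h2 := Polynomial.natDegree_le_of_dvd h1 hne
        rw [Polynomial.natDegree_X_pow] at h2
        omega
      apply Subtype.val_injective
      rw [← hf i, hf0, map_zero]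
      rfl
    have hli' := (LinearIndependent.iff_fractionRing (Algebra.adjoin F {(x : K)})
      (IntermediateField.adjoin F {(x : K)})).1 hli
    simpa using hli'.fintype_card_le_finrank
  have : Module.Finite F (D ⧸ Ideal.span {x}) :=
    Module.rank_lt_aleph0_iff.1 (hrank.trans_lt (Cardinal.natCast_lt_aleph0))
  exact Module.finite_of_finite F

theorem SIntegers.hasFiniteQuotients (F : Type*) {K : Type*} [Field F] [Finite F] [Field K]
    [Algebra (RatFunc F) K] [FunctionField F K] (S : Set (Place K)) :
    Ring.HasFiniteQuotients (SIntegers S) := by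
  let algFK : Algebra F K := ((algebraMap (RatFunc F) K).comp (algebraMap F (RatFunc F))).toAlgebra
  have towerFK : IsScalarTower F (RatFunc F) K := IsScalarTower.of_algebraMap_eq' rfl
  have hF : ∀ c : F, algebraMap F K c ∈ SIntegers S := fun c => by
    refine SIntegers.mem_of_isIntegral ?_
    have h : IsIntegral ℤ (algebraMap F K c) :=
      ((Algebra.IsIntegral.of_finite ℤ F).isIntegral c).map (algebraMap F K).toIntAlgHom
    exact h.tower_top
  let algFD : Algebra F (SIntegers S) := ((algebraMap F K).codRestrict (SIntegers S) hF).toAlgebra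
  have towerFD : IsScalarTower F (SIntegers S) K := IsScalarTower.of_algebraMap_eq' rfl
  refine ⟨fun {I} hI => ?_⟩
  obtain ⟨x, hxI, hx0⟩ := Submodule.exists_mem_ne_zero_of_ne_bot hI
  have hfin : Finite (SIntegers S ⧸ Ideal.span {x}) := by
    by_cases hx : Transcendental F (x : K)
    · have := FunctionField.finiteDimensional_of_adjoin_transcendental hx
      exact finite_quotient_span_of_transcendental (SIntegers S) x hx
    -- A nonzero x algebraic over F has an inverse integral over F, so x is a unit and the quotient
    -- is trivial.
    · have hinv : IsIntegral F (x : K)⁻¹ := (not_not.1 hx).inv.isIntegral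
      have hmem : (x : K)⁻¹ ∈ SIntegers S := SIntegers.mem_of_isIntegral hinv.tower_top
      have hunit : IsUnit x := IsUnit.of_mul_eq_one ⟨_, hmem⟩
        (Subtype.val_injective (mul_inv_cancel₀ (by simpa using hx0)))
      rw [Ideal.span_singleton_eq_top.2 hunit]
      infer_instance
  exact Finite.of_surjective _
    (Ideal.Quotient.factor_surjective ((Ideal.span_singleton_le_iff_mem I).2 hxI))

theorem SIntegers.isDedekindDomain (F : Type*) {K : Type*} [Field F] [Finite F] [Field K]
    [Algebra (RatFunc F) K] [FunctionField F K] (S : Set (Place K)) :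
    IsDedekindDomain (SIntegers S) := by
  have := SIntegers.hasFiniteQuotients F S
  have := Subring.isIntegrallyClosed_of_forall_isIntegral (SIntegers S)
    fun x => SIntegers.mem_of_isIntegral
  exact { }

theorem SIntegers.charP (F : Type*) {K : Type*} [Field F] [Field K] [Algebra (RatFunc F) K]
    (S : Set (Place K)) (p : ℕ) [CharP F p] : CharP (SIntegers S) p := by
  have : CharP K p := charP_of_injective_ringHom
    ((algebraMap (RatFunc F) K).comp (algebraMap F (RatFunc F))).injective p
  exact (RingHom.charP_iff (SIntegers S).subtype Subtype.val_injective p).2 this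

end FunctionField

theorem theorem5p8 {Fq K : Type*} [Field Fq] [Finite Fq] [Field K]
    [Algebra (RatFunc Fq) K] [FunctionField Fq K]
    (S : Set (Place K)) (hS : S.Finite)
    (N : Subgroup (Matrix.SpecialLinearGroup (Fin 2) (SIntegers S)))
    (hnormal : N.Normal) (hN : IsCongruenceSubgroup N) :
    N.FiniteIndex ∧
    (CharP Fq 3 →
      (primesOfResidueCard (SIntegers S) 3).Finite ∧
      Nat.card (SIntegers S ⧸ level N) ∣
        3 ^ (primesOfResidueCard (SIntegers S) 3).ncard * N.index) ∧
    (CharP Fq 2 →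
      (primesOfResidueCard (SIntegers S) 2).Finite ∧
      Nat.card (SIntegers S ⧸ level N) ∣
        4 ^ (primesOfResidueCard (SIntegers S) 2).ncard * N.index ^ 2) := by
  have := SIntegers.hasFiniteQuotients Fq S
  have := SIntegers.isDedekindDomain Fq S
  refine ⟨hN.finiteIndex, fun _ => ⟨finite_primesOfResidueCard _ 3, ?_⟩,
    fun _ => ⟨finite_primesOfResidueCard _ 2, ?_⟩⟩
  · have := SIntegers.charP Fq S 3
    have h := natCard_quotient_level_dvd 3 3 1 Nat.prime_three
      (fun _ _ _ _ _ _ _ _ hPQ => by rw [pow_one]; exact hPQ.exists_ideal_char_three)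
      (finite_primesOfResidueCard (SIntegers S) 3) N hN
    rwa [pow_one] at h
  · have := SIntegers.charP Fq S 2
    exact natCard_quotient_level_dvd 2 4 2 Nat.prime_two
      (fun _ _ _ _ _ _ _ _ hPQ => hPQ.exists_ideal_char_two)
      (finite_primesOfResidueCard (SIntegers S) 2) N hN
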